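/- For $\tau\in\mathbb{R}$ define the greedy approximation of $\tau$ by signed harmonic sums by $\sigma_0(\tau):=0$ and, for $n\ge 1$, $$s_n(\tau):=\begin{cases}1,&\text{if }\sigma_{n-1}(\tau)\le\tau,\\-1,&\text{if }\sigma_{n-1}(\tau)>\tau,\end{cases}\qquad \sigma_n(\tau):=\sum_{m=1}^n\frac{s_m(\tau)}{m}.$$ For an integer $k\ge 0$ let $S_k'(\tau)\subseteq\mathbb{R}\cup\{\pm\infty\}$ be the set of limit points (limits of subsequences, in the extended real line) of the sequence $\big((\sigma_n(\tau)-\tau)\,n^k\big)_{n\ge1}$, and let $c_k:=2^{\binom{k}{2}}\,k!$. Let $\varepsilon_n:=1$ if the binary expansion of $n$ has an even number of ones and $\varepsilon_n:=-1$ otherwise, and let $f_k$ be the $2^k$-periodic function with $f_k(n)=\varepsilon_n$ for $0\le n<2^k$. For $k\ge1$ let $X_k$ be the set of all $\tau\in\mathbb{R}$ for which there are integers $N\ge 0$ and $0\le m<2^k$ such that $s_n(\tau)=f_k(n+m)$ for all $n\ge \max(N,1)$, and let $Y_\infty:=\bigcup_{h\ge1}X_h$. Then for all integers $k\ge0$ and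 all $\tau\in\mathbb{R}$ one has $$S_{k+1}'(\tau)\subseteq\{0,\pm c_k,\pm c_k/2,\pm\infty\}.$$ Moreover, if $\tau\notin Y_\infty$, then $S_{k+1}'(\tau)=\{0,\pm c_k,\pm\infty\}$ for every integer $k\ge1$. -/

import Mathlib

noncomputable section

/-- The greedy partial sums `σ_n(τ)`: `σ_0 = 0`, and `σ_{n+1} = σ_n + 1/(n+1)` if `σ_n ≤ τ`,
`σ_{n+1} = σ_n - 1/(n+1)` if `τ < σ_n`. -/
def greedySum (τ : ℝ) : ℕ → ℝ
  | 0 => 0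
  | n + 1 => greedySum τ n + (if greedySum τ n ≤ τ then 1 else -1) / ((n : ℝ) + 1)

/-- The greedy signs `s_n(τ)`, meaningful for `n ≥ 1`:
`s_n = 1` if `σ_{n-1} ≤ τ` and `s_n = -1` otherwise. -/
def greedySign (τ : ℝ) (n : ℕ) : ℝ :=
  if greedySum τ (n - 1) ≤ τ then 1 else -1

/-- `σ_n(τ) = ∑_{m=1}^n s_m(τ)/m`. -/
theorem greedySum_eq_sum (τ : ℝ) (n : ℕ) :
    greedySum τ n = ∑ m ∈ Finset.Icc 1 n, greedySign τ m / (m : ℝ) := by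
  induction n with
  | zero => simp [greedySum]
  | succ n ih =>
    rw [Finset.sum_Icc_succ_top (by omega), ← ih]
    simp [greedySum, greedySign]

/-- The `±1`-valued Thue-Morse sequence: `ε_n = 1` if the binary expansion of `n` has an even number
of ones, `ε_n = -1` otherwise. -/
def thueMorseSign (n : ℕ) : ℝ :=
  (-1) ^ ((Nat.digits 2 n).count 1)

/-- The `2^k`-periodic function `f_k` that agrees with `ε` on `[0, 2^k)`. -/
def periodicThueMorse (k n : ℕ) : ℝ :=
  thueMorseSign (n % 2 ^ k)

/-- The exceptional set `X_k`: those `τ` for which there are `N ≥ 0` and `0 ≤ m < 2^k` with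
`s_n(τ) = f_k(n + m)` for all `n ≥ N` (the index `n` of a sign being at least `1`). -/
def exceptionalSet (k : ℕ) : Set ℝ :=
  {τ | ∃ N m : ℕ, m < 2 ^ k ∧
    ∀ n : ℕ, 1 ≤ n → N ≤ n → greedySign τ n = periodicThueMorse k (n + m)}

/-- `Y_∞ = ⋃_{h ≥ 1} X_h`. -/
def exceptionalUnion : Set ℝ :=
  {τ | ∃ h : ℕ, 1 ≤ h ∧ τ ∈ exceptionalSet h}

/-- `c_k = 2^(k choose 2) * k!`. -/
def cConst (k : ℕ) : ℝ :=
  2 ^ (k.choose 2) * (k.factorial : ℝ)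

/-- The limit points, in the extended real line, of the sequence `(σ_n(τ) - τ) * n^k`, that is,
its cluster points as `n → ∞` (the limits of its subsequences). -/
def limitPoints (k : ℕ) (τ : ℝ) : Set EReal :=
  {x | MapClusterPt x Filter.atTop
    (fun n : ℕ => (((greedySum τ n - τ) * (n : ℝ) ^ k : ℝ) : EReal))}

end

/-!
Write `u_n = σ_n(τ) - τ`. Since `s_{n+1}` is opposite in sign to `u_n`, the size `|u_n|` soon drops
to at most `1 / n`. The proof looks at the error along a progression `a + 2 ^ k * i` on which the
signs come in blocks `±(ε_0, …, ε_{2^k-1})`. One block moves the error, towards zero, by the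
iterated difference `D_k(n) = ∑_{j < 2^k} ε_j / (n + 1 + j)`, which is positive, decreasing and
asymptotic to `c_k / n ^ (k + 1)` (`dyadicDiff_bounds`, `tendsto_dyadicDiff`). The predicate `GreedyRegular` says
that this holds with an error of size at most one such step on the progression, and of size at
least of order `n ^ (-k)` off it. There is a regular progression of level `0`.

Given a regular progression of level `k`, there are two cases
(`GreedyRegular.succ_or_alternating`).

* The block signs fail to alternate at arbitrarily late places. If the blocks after `n` and after
  `n + 2^k` have the same sign, then the error at `n`, at most `D_k(n - 2^k)`, is reduced by
  `D_k(n)` without crossing zero, so the error at `n + 2^k` is at most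
  `D_k(n - 2^k) - D_k(n) = D_{k+1}(n - 2^k)`. This is so small compared with `D_k` that the signs
  alternate from there on, and every second term forms a regular progression of level `k + 1`. On
  it `u_n n^(k+1) → 0`, on the other terms `|u_n| n^(k+1) → c_k`, and off the progression of
  level `k` the scaled error tends to infinity.
* The block signs alternate from some point on. Then `τ ∈ X_{k+1}`
  (`GreedyRegular.mem_exceptionalSet`), and by convexity of `D_k` the error is squeezed between
  halves of two consecutive steps, so `|u_n| n^(k+1) → c_k / 2` on the progression
  (`GreedyRegular.eventually_near_half`). In particular `|u_n|` is at least of order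
  `n ^ (-(k + 1))` everywhere, and at higher levels only `±∞` can be limit points.

For `τ ∉ Y_∞` the first case occurs at every level. Regularity two levels up shows that both signs
recur at every position of the blocks (`GreedyRegular.frequently_sign`), so each of `±c_k` and `±∞`
is attained.
-/

open Filter Topology

/-! ### Iterated differences of inverse powers -/

/-- The iterated difference of `x ↦ 1 / x ^ p` with steps `1, 2, 4, …, 2 ^ (k - 1)`. Its expansion
is `∑ ε_j / (x + j) ^ p` over `j < 2 ^ k`, with the Thue-Morse signs `ε_j`. -/
noncomputable def dyadicDiff : ℕ → ℕ → ℝ → ℝ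
  | 0, p, x => (x ^ p)⁻¹
  | k + 1, p, x => dyadicDiff k p x - dyadicDiff k p (x + 2 ^ k)

/-- The leading coefficient of `dyadicDiff k p` at infinity. -/
noncomputable def dyadicCoeff (k p : ℕ) : ℝ := 2 ^ (k.choose 2) * (p.ascFactorial k : ℝ)

theorem dyadicCoeff_one (k : ℕ) : dyadicCoeff k 1 = cConst k := by
  simp [dyadicCoeff, cConst, Nat.one_ascFactorial]

theorem cConst_pos (k : ℕ) : 0 < cConst k := by
  unfold cConst; positivity

theorem dyadicCoeff_succ (k p : ℕ) :
    dyadicCoeff (k + 1) p = 2 ^ k * p * dyadicCoeff k (p + 1) := by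
  have h : p.ascFactorial (k + 1) = p * (p + 1).ascFactorial k := by
    rw [Nat.ascFactorial_succ, ← Nat.succ_ascFactorial]
  unfold dyadicCoeff
  rw [h, Nat.choose_succ_succ' k 1, Nat.choose_one_right, pow_add]
  push_cast
  ring

theorem hasDerivAt_dyadicDiff (k p : ℕ) {x : ℝ} (hx : 0 < x) :
    HasDerivAt (dyadicDiff k p) (-(p * dyadicDiff k (p + 1) x)) x := by
  induction k generalizing x with
  | zero =>
    have h := (hasDerivAt_pow p x).inv (pow_ne_zero p hx.ne')
    have he : dyadicDiff 0 p = (fun y : ℝ => y ^ p)⁻¹ := by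
      ext y; simp [dyadicDiff]
    rw [he]
    refine h.congr_deriv ?_
    rcases p with _ | p
    · simp
    · simp only [dyadicDiff, Nat.add_sub_cancel]
      field_simp
      ring
  | succ k ih =>
    have h1 := ih hx
    have h2 := (ih (x := x + 2 ^ k) (by positivity)).comp_add_const x (2 ^ k)
    refine (h1.sub h2).congr_deriv ?_
    simp only [dyadicDiff]
    ring

/-- Two-sided bounds for the iterated differences: each difference is a derivative at an
intermediate point, and the derivative of `dyadicDiff k p` is `-p` times `dyadicDiff k (p + 1)`. -/
theorem dyadicDiff_bounds (k p : ℕ) {x : ℝ} (hx : 0 < x) :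
    dyadicCoeff k p / (x + 2 ^ k) ^ (p + k) ≤ dyadicDiff k p x ∧
      dyadicDiff k p x ≤ dyadicCoeff k p / x ^ (p + k) := by
  induction k generalizing p x with
  | zero =>
    simp only [dyadicCoeff, dyadicDiff]
    simp only [Nat.choose_zero_succ, pow_zero, Nat.ascFactorial_zero, Nat.cast_one, mul_one,
      add_zero, one_div, le_refl, and_true]
    gcongr
    linarith
  | succ k ih =>
    have hlt : x < x + 2 ^ k := by
      have : (0 : ℝ) < 2 ^ k := by positivity
      linarith
    obtain ⟨y, ⟨hy1, hy2⟩, hy⟩ := exists_hasDerivAt_eq_slope (dyadicDiff k p)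
      (fun y => -(p * dyadicDiff k (p + 1) y)) hlt
      (fun y hy => (hasDerivAt_dyadicDiff k p (hx.trans_le hy.1)).continuousAt.continuousWithinAt)
      (fun y hy => hasDerivAt_dyadicDiff k p (hx.trans hy.1))
    have hy0 : 0 < y := hx.trans hy1
    have key : dyadicDiff (k + 1) p x = 2 ^ k * p * dyadicDiff k (p + 1) y := by
      rw [add_sub_cancel_left, eq_div_iff (by positivity)] at hy
      simp only [dyadicDiff]
      linarith
    have hc : 0 ≤ dyadicCoeff k (p + 1) := by unfold dyadicCoeff; positivity
    obtain ⟨h1, h2⟩ := ih (p + 1) hy0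
    have hp : p + (k + 1) = p + 1 + k := by ring
    rw [key, dyadicCoeff_succ, mul_div_assoc, mul_div_assoc, hp]
    constructor
    · refine mul_le_mul_of_nonneg_left (le_trans ?_ h1) (by positivity)
      have : y + 2 ^ k ≤ x + 2 ^ (k + 1) := by rw [pow_succ]; linarith
      gcongr
    · refine mul_le_mul_of_nonneg_left (h2.trans ?_) (by positivity)
      gcongr

theorem dyadicDiff_one_pos (k : ℕ) {x : ℝ} (hx : 0 < x) : 0 < dyadicDiff k 1 x := by
  refine lt_of_lt_of_le ?_ (dyadicDiff_bounds k 1 hx).1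
  rw [dyadicCoeff_one]
  have := cConst_pos k
  positivity

theorem dyadicDiff_nonneg (k p : ℕ) {x : ℝ} (hx : 0 < x) : 0 ≤ dyadicDiff k p x := by
  refine le_trans ?_ (dyadicDiff_bounds k p hx).1
  unfold dyadicCoeff
  positivity

theorem dyadicDiff_antitone (k p : ℕ) {x y : ℝ} (hx : 0 < x) (hxy : x ≤ y) :
    dyadicDiff k p y ≤ dyadicDiff k p x := by
  refine antitoneOn_of_deriv_nonpos (convex_Ioi (0 : ℝ))
    (fun z hz => (hasDerivAt_dyadicDiff k p hz).continuousAt.continuousWithinAt)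
    (fun z hz => ?_) (fun z hz => ?_) hx (hx.trans_le hxy) hxy
  · rw [interior_Ioi] at hz
    exact (hasDerivAt_dyadicDiff k p hz).differentiableAt.differentiableWithinAt
  · rw [interior_Ioi] at hz
    rw [(hasDerivAt_dyadicDiff k p hz).deriv]
    have := dyadicDiff_nonneg k (p + 1) hz
    have : 0 ≤ p * dyadicDiff k (p + 1) z := by positivity
    linarith

/-- `dyadicDiff k 1 x ∼ c_k / x ^ (k + 1)`, along shifted integers. -/
theorem tendsto_dyadicDiff (k : ℕ) (b : ℝ) :
    Tendsto (fun n : ℕ => dyadicDiff k 1 (n + b) * (n : ℝ) ^ (k + 1)) atTop (𝓝 (cConst k)) := by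
  have hratio : ∀ d : ℝ, Tendsto (fun n : ℕ =>
      cConst k * ((n : ℝ) / (n + d)) ^ (k + 1)) atTop (𝓝 (cConst k)) := by
    intro d
    have h := (tendsto_natCast_div_add_atTop d).pow (k + 1) |>.const_mul (cConst k)
    simpa using h
  have hev : ∀ᶠ n : ℕ in atTop, 0 < (n : ℝ) + b :=
    (tendsto_atTop_add_const_right _ b tendsto_natCast_atTop_atTop).eventually_gt_atTop 0
  refine tendsto_of_tendsto_of_tendsto_of_le_of_le' (hratio (b + 2 ^ k)) (hratio b) ?_ ?_
  · filter_upwards [hev] with n hn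
    have h := (dyadicDiff_bounds k 1 hn).1
    rw [dyadicCoeff_one, add_comm 1 k, add_assoc] at h
    calc _ = cConst k / (n + (b + 2 ^ k)) ^ (k + 1) * (n : ℝ) ^ (k + 1) := by
          rw [div_pow]; ring
      _ ≤ _ := by gcongr
  · filter_upwards [hev] with n hn
    have h := (dyadicDiff_bounds k 1 hn).2
    rw [dyadicCoeff_one, add_comm 1 k] at h
    calc _ ≤ cConst k / (n + b) ^ (k + 1) * (n : ℝ) ^ (k + 1) := by gcongr
      _ = _ := by rw [div_pow]; ring

theorem tendsto_dyadicDiff_succ_zero (k : ℕ) (b : ℝ) :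
    Tendsto (fun n : ℕ => dyadicDiff (k + 1) 1 (n + b) * (n : ℝ) ^ (k + 1)) atTop (𝓝 0) := by
  have h := (tendsto_dyadicDiff (k + 1) b).mul (tendsto_inv_atTop_nhds_zero_nat (𝕜 := ℝ))
  rw [mul_zero] at h
  refine h.congr' ?_
  filter_upwards [eventually_gt_atTop 0] with n hn
  have : (n : ℝ) ≠ 0 := by positivity
  rw [pow_succ _ (k + 1)]
  field_simp

/-! ### Thue-Morse signs -/

theorem thueMorseSign_zero : thueMorseSign 0 = 1 := by simp [thueMorseSign]

theorem thueMorseSign_two_mul (n : ℕ) : thueMorseSign (2 * n) = thueMorseSign n := by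
  rcases Nat.eq_zero_or_pos n with rfl | hn
  · rfl
  · unfold thueMorseSign
    rw [Nat.digits_def' (by norm_num) (by omega)]
    simp

theorem thueMorseSign_two_mul_add_one (n : ℕ) :
    thueMorseSign (2 * n + 1) = -thueMorseSign n := by
  unfold thueMorseSign
  rw [Nat.digits_def' (by norm_num) (by omega), Nat.mul_add_mod, Nat.mul_add_div (by norm_num)]
  simp [pow_succ]

theorem thueMorseSign_two_pow_add (k : ℕ) {j : ℕ} (hj : j < 2 ^ k) :
    thueMorseSign (2 ^ k + j) = -thueMorseSign j := by
  induction k generalizing j with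
  | zero =>
    obtain rfl : j = 0 := by simpa using hj
    simpa using thueMorseSign_two_mul_add_one 0
  | succ k ih =>
    rw [pow_succ] at hj ⊢
    obtain ⟨i, rfl | rfl⟩ : ∃ i, j = 2 * i ∨ j = 2 * i + 1 := ⟨j / 2, by omega⟩
    · rw [show 2 ^ k * 2 + 2 * i = 2 * (2 ^ k + i) by ring, thueMorseSign_two_mul,
        thueMorseSign_two_mul, ih (by omega)]
    · rw [show 2 ^ k * 2 + (2 * i + 1) = 2 * (2 ^ k + i) + 1 by ring,
        thueMorseSign_two_mul_add_one, thueMorseSign_two_mul_add_one, ih (by omega)]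

/-! ### The error of the greedy sums -/

/-- The error `σ_n(τ) - τ`. -/
noncomputable def greedyError (τ : ℝ) (n : ℕ) : ℝ := greedySum τ n - τ

theorem greedyError_succ (τ : ℝ) (n : ℕ) :
    greedyError τ (n + 1) = greedyError τ n + greedySign τ (n + 1) / (n + 1) := by
  simp only [greedyError, greedySum, greedySign, Nat.add_sub_cancel]
  ring

theorem greedySign_eq (τ : ℝ) (n : ℕ) : greedySign τ n = 1 ∨ greedySign τ n = -1 := by
  unfold greedySign
  split_ifs <;> simp

theorem greedySign_mul_self (τ : ℝ) (n : ℕ) : greedySign τ n * greedySign τ n = 1 := by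
  rcases greedySign_eq τ n with h | h <;> simp [h]

theorem abs_greedySign (τ : ℝ) (n : ℕ) : |greedySign τ n| = 1 := by
  rcases greedySign_eq τ n with h | h <;> simp [h]

/-- The next greedy sign points from the partial sum towards `τ`. -/
theorem abs_greedyError (τ : ℝ) (n : ℕ) :
    |greedyError τ n| = -(greedySign τ (n + 1) * greedyError τ n) := by
  unfold greedySign greedyError
  rw [Nat.add_sub_cancel]
  split_ifs with h
  · rw [abs_of_nonpos (by linarith)]; ring
  · rw [abs_of_pos (by linarith)]; ring

theorem greedySign_succ_eq_neg {τ : ℝ} {n m : ℕ}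
    (h : 0 < greedySign τ m * greedyError τ n) : greedySign τ (n + 1) = -greedySign τ m := by
  have h1 := abs_greedyError τ n
  have h2 := abs_nonneg (greedyError τ n)
  rcases greedySign_eq τ m with hm | hm <;> rcases greedySign_eq τ (n + 1) with hn | hn <;>
    rw [hm] at h ⊢ <;> rw [hn] at h1 ⊢ <;> linarith

/-- Once the partial sums have crossed `τ`, the error stays below the last step; they do cross it,
since the harmonic series diverges. -/
theorem exists_abs_greedyError_le (τ : ℝ) :
    ∃ a : ℕ, 1 ≤ a ∧ ∀ n, a ≤ n → |greedyError τ n| ≤ 1 / n := by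
  have hstep : ∀ n : ℕ, |greedyError τ (n + 1)| = |(|greedyError τ n| - 1 / ((n : ℝ) + 1))| := by
    intro n
    have h : |greedyError τ n| - 1 / ((n : ℝ) + 1)
        = -greedySign τ (n + 1) * greedyError τ (n + 1) := by
      rw [greedyError_succ, abs_greedyError]
      have := greedySign_mul_self τ (n + 1)
      linear_combination (1 / ((n : ℝ) + 1)) * this
    rw [h, abs_mul, abs_neg, abs_greedySign, one_mul]
  by_cases hex : ∃ a : ℕ, 1 ≤ a ∧ |greedyError τ a| ≤ 1 / a
  · obtain ⟨a, ha, h0⟩ := hex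
    refine ⟨a, ha, fun n hn => ?_⟩
    induction n, hn using Nat.le_induction with
    | base => exact h0
    | succ n hn ih =>
      have hn0 : (1 : ℝ) ≤ n := by exact_mod_cast ha.trans hn
      have h2 : (1 : ℝ) / n ≤ 2 * (1 / (n + 1)) := by
        rw [mul_one_div, div_le_div_iff₀ (by linarith) (by linarith)]; linarith
      have h3 := abs_nonneg (greedyError τ n)
      rw [hstep, abs_le]
      push_cast
      constructor <;> linarith
  · exfalso
    push Not at hex
    have hdec : ∀ n : ℕ, |greedyError τ (n + 1)|
        = |greedyError τ 1| + 1 - ∑ i ∈ Finset.range (n + 1), 1 / ((i : ℝ) + 1) := by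
      intro n
      induction n with
      | zero => simp
      | succ n ih =>
        rw [Finset.sum_range_succ, hstep, abs_of_nonneg, ih]
        · ring
        · have h := hex (n + 1) (by omega)
          have h' : 1 / (((n + 1 : ℕ) : ℝ) + 1) ≤ 1 / ((n + 1 : ℕ) : ℝ) := by
            gcongr; linarith
          linarith
    have ht := Real.tendsto_sum_range_one_div_nat_succ_atTop.comp (tendsto_add_atTop_nat 1)
    obtain ⟨n, hn⟩ := (ht.eventually_gt_atTop (|greedyError τ 1| + 1)).exists
    have h := hdec n
    have h' := abs_nonneg (greedyError τ (n + 1))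
    simp only [Function.comp_apply] at hn
    linarith

/-! ### Regular progressions -/

/-- `GreedyRegular τ k a`: from `a` on, the greedy signs come in blocks of length `2 ^ k`, each `±`
the Thue-Morse block, whose indices start right after the terms of the progression `a + 2 ^ k * i`.
On the progression the error moves by one iterated difference per block and is bounded by the
preceding such difference; off the progression it is at least of order `1 / n ^ k`. The condition
`2 ^ k ≤ a` keeps the arguments of `dyadicDiff` positive. -/
structure GreedyRegular (τ : ℝ) (k a : ℕ) : Prop where
  le : 2 ^ k ≤ a
  sign : ∀ i r, r < 2 ^ k → greedySign τ (a + 2 ^ k * i + r + 1)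
    = greedySign τ (a + 2 ^ k * i + 1) * thueMorseSign r
  step : ∀ i, greedyError τ (a + 2 ^ k * (i + 1)) = greedyError τ (a + 2 ^ k * i)
    + greedySign τ (a + 2 ^ k * i + 1) * dyadicDiff k 1 ((a + 2 ^ k * i : ℕ) + 1)
  bound : ∀ i, |greedyError τ (a + 2 ^ k * i)|
    ≤ dyadicDiff k 1 ((a + 2 ^ k * i : ℕ) + (1 - 2 ^ k))
  off : ∃ δ > 0, ∀ n ≥ a, (∃ i, n = a + 2 ^ k * i) ∨ δ ≤ |greedyError τ n| * (n : ℝ) ^ k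

theorem exists_greedyRegular_zero (τ : ℝ) : ∃ a, GreedyRegular τ 0 a := by
  obtain ⟨a, ha, h⟩ := exists_abs_greedyError_le τ
  refine ⟨a, ⟨by simpa using ha, ?_, ?_, ?_, 1, one_pos, ?_⟩⟩
  · intro i r hr
    obtain rfl : r = 0 := by simpa using hr
    simp [thueMorseSign_zero]
  · intro i
    rw [pow_zero, one_mul, one_mul, ← add_assoc, greedyError_succ]
    simp [dyadicDiff, div_eq_mul_inv]
  · intro i
    simpa [dyadicDiff] using h (a + i) (by omega)
  · intro n hn
    exact Or.inl ⟨n - a, by simp; omega⟩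

namespace GreedyRegular

variable {τ : ℝ} {k a : ℕ}

theorem cast_next (k a i : ℕ) :
    ((a + 2 ^ k * (i + 1) : ℕ) : ℝ) = (a + 2 ^ k * i : ℕ) + 2 ^ k := by
  push_cast; ring

theorem abs_next_of_neg (h : GreedyRegular τ k a) {i : ℕ}
    (hs : greedySign τ (a + 2 ^ k * (i + 1) + 1) = -greedySign τ (a + 2 ^ k * i + 1)) :
    |greedyError τ (a + 2 ^ k * (i + 1))|
      = dyadicDiff k 1 ((a + 2 ^ k * i : ℕ) + 1) - |greedyError τ (a + 2 ^ k * i)| := by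
  rw [abs_greedyError, abs_greedyError, hs, h.step]
  linear_combination dyadicDiff k 1 ((a + 2 ^ k * i : ℕ) + 1)
    * greedySign_mul_self τ (a + 2 ^ k * i + 1)

theorem abs_next_of_eq (h : GreedyRegular τ k a) {i : ℕ}
    (hs : greedySign τ (a + 2 ^ k * (i + 1) + 1) = greedySign τ (a + 2 ^ k * i + 1)) :
    |greedyError τ (a + 2 ^ k * (i + 1))|
      = |greedyError τ (a + 2 ^ k * i)| - dyadicDiff k 1 ((a + 2 ^ k * i : ℕ) + 1) := by
  rw [abs_greedyError, abs_greedyError, hs, h.step]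
  linear_combination -dyadicDiff k 1 ((a + 2 ^ k * i : ℕ) + 1)
    * greedySign_mul_self τ (a + 2 ^ k * i + 1)

theorem sign_next_eq_neg (h : GreedyRegular τ k a) {i : ℕ}
    (hb : |greedyError τ (a + 2 ^ k * i)| < dyadicDiff k 1 ((a + 2 ^ k * i : ℕ) + 1)) :
    greedySign τ (a + 2 ^ k * (i + 1) + 1) = -greedySign τ (a + 2 ^ k * i + 1) := by
  apply greedySign_succ_eq_neg
  have h1 : greedySign τ (a + 2 ^ k * i + 1) * greedyError τ (a + 2 ^ k * (i + 1))
      = dyadicDiff k 1 ((a + 2 ^ k * i : ℕ) + 1) - |greedyError τ (a + 2 ^ k * i)| := by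
    rw [abs_greedyError, h.step]
    linear_combination dyadicDiff k 1 ((a + 2 ^ k * i : ℕ) + 1)
      * greedySign_mul_self τ (a + 2 ^ k * i + 1)
  rw [h1]
  linarith

/-- Two steps with opposite signs amount to one step of the next level. -/
theorem step_two (h : GreedyRegular τ k a) {i : ℕ}
    (hs : greedySign τ (a + 2 ^ k * (i + 1) + 1) = -greedySign τ (a + 2 ^ k * i + 1)) :
    greedyError τ (a + 2 ^ k * (i + 2)) = greedyError τ (a + 2 ^ k * i)
      + greedySign τ (a + 2 ^ k * i + 1) * dyadicDiff (k + 1) 1 ((a + 2 ^ k * i : ℕ) + 1) := by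
  rw [show i + 2 = i + 1 + 1 by ring, h.step (i + 1), hs, h.step, cast_next]
  simp only [dyadicDiff]
  rw [add_right_comm _ (2 ^ k) (1 : ℝ)]
  ring

/-- If the signs fail to alternate on a regular progression, arbitrarily far out, then at such a
failure the error is so small that the signs alternate from there on, and every second term forms
a regular progression of the next level. -/
theorem succ_or_alternating (h : GreedyRegular τ k a) :
    (∃ i, GreedyRegular τ (k + 1) (a + 2 ^ k * i)) ∨
      ∃ i₀, ∀ i ≥ i₀,
        greedySign τ (a + 2 ^ k * (i + 1) + 1) = -greedySign τ (a + 2 ^ k * i + 1) := by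
  by_cases halt : ∃ i₀, ∀ i ≥ i₀,
      greedySign τ (a + 2 ^ k * (i + 1) + 1) = -greedySign τ (a + 2 ^ k * i + 1)
  · exact Or.inr halt
  left
  push Not at halt
  have hc := cConst_pos k
  -- `D_{k+1}` is negligible against `D_k`, so an error of that size changes sign at the next step.
  have hgap : ∀ᶠ n : ℕ in atTop, cConst k / 2 ≤ (dyadicDiff k 1 (n + 1)
      - dyadicDiff (k + 1) 1 (n + (1 - 2 ^ (k + 1)))) * (n : ℝ) ^ (k + 1) := by
    have h1 := (tendsto_dyadicDiff k 1).sub (tendsto_dyadicDiff_succ_zero k (1 - 2 ^ (k + 1)))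
    filter_upwards [h1.eventually (eventually_ge_nhds (b := cConst k / 2) (by linarith))]
      with n hn
    linarith
  -- A step of level `k + 1` is at least half the preceding one, so an error bounded by the
  -- preceding step is, after this step, bounded by this step.
  have hdouble : ∀ᶠ n : ℕ in atTop, dyadicDiff (k + 1) 1 (n + (1 - 2 ^ (k + 1)))
      ≤ 2 * dyadicDiff (k + 1) 1 (n + 1) := by
    have hc' := cConst_pos (k + 1)
    have h1 := ((tendsto_dyadicDiff (k + 1) 1).const_mul 2).sub
      (tendsto_dyadicDiff (k + 1) (1 - 2 ^ (k + 1)))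
    filter_upwards [h1.eventually (eventually_gt_nhds (b := 0) (by linarith)),
      eventually_gt_atTop 0] with n hn hn0
    have hp : (0 : ℝ) < (n : ℝ) ^ (k + 1 + 1) := by positivity
    by_contra! hlt
    have := mul_lt_mul_of_pos_right hlt hp
    linarith
  obtain ⟨M, hM⟩ := eventually_atTop.1 ((hgap.and hdouble).and (eventually_gt_atTop 0))
  -- The new progression starts at the second of two consecutive terms with the same sign.
  obtain ⟨i, hi, hsi⟩ := halt M
  have hsame : greedySign τ (a + 2 ^ k * (i + 1) + 1) = greedySign τ (a + 2 ^ k * i + 1) := by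
    rcases greedySign_eq τ (a + 2 ^ k * (i + 1) + 1) with h1 | h1 <;>
      rcases greedySign_eq τ (a + 2 ^ k * i + 1) with h2 | h2 <;>
      rw [h1, h2] at hsi ⊢ <;> simp at hsi
  have hpk : 0 < 2 ^ k := by positivity
  have hlarge : ∀ j, M ≤ a + 2 ^ k * (i + 1 + 2 * j) := by
    intro j
    calc M ≤ 1 * (i + 1 + 2 * j) := by omega
      _ ≤ 2 ^ k * (i + 1 + 2 * j) := Nat.mul_le_mul_right _ hpk
      _ ≤ _ := Nat.le_add_left _ _
  have hidx : ∀ j, a + 2 ^ k * (i + 1) + 2 ^ (k + 1) * j = a + 2 ^ k * (i + 1 + 2 * j) := by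
    intro j; ring
  have hlt : ∀ j, |greedyError τ (a + 2 ^ k * (i + 1 + 2 * j))|
      ≤ dyadicDiff (k + 1) 1 ((a + 2 ^ k * (i + 1 + 2 * j) : ℕ) + (1 - 2 ^ (k + 1))) →
      |greedyError τ (a + 2 ^ k * (i + 1 + 2 * j))|
        < dyadicDiff k 1 ((a + 2 ^ k * (i + 1 + 2 * j) : ℕ) + 1) := by
    intro j hj
    obtain ⟨⟨h1, -⟩, h3⟩ := hM _ (hlarge j)
    have h4 : 0 < dyadicDiff k 1 ((a + 2 ^ k * (i + 1 + 2 * j) : ℕ) + 1)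
        - dyadicDiff (k + 1) 1 ((a + 2 ^ k * (i + 1 + 2 * j) : ℕ) + (1 - 2 ^ (k + 1))) := by
      refine pos_of_mul_pos_left (lt_of_lt_of_le (by linarith) h1) (by positivity)
    linarith
  have hbound : ∀ j, |greedyError τ (a + 2 ^ k * (i + 1 + 2 * j))|
      ≤ dyadicDiff (k + 1) 1 ((a + 2 ^ k * (i + 1 + 2 * j) : ℕ) + (1 - 2 ^ (k + 1))) := by
    intro j
    induction j with
    | zero =>
      rw [mul_zero, add_zero, h.abs_next_of_eq hsame, cast_next]
      have h1 := h.bound i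
      have h2 : ((a + 2 ^ k * i : ℕ) : ℝ) + 2 ^ k + (1 - 2 ^ (k + 1))
          = (a + 2 ^ k * i : ℕ) + (1 - 2 ^ k) := by ring
      have h3 : ((a + 2 ^ k * i : ℕ) : ℝ) + (1 - 2 ^ k) + 2 ^ k = (a + 2 ^ k * i : ℕ) + 1 := by
        ring
      rw [h2]
      simp only [dyadicDiff]
      rw [h3]
      linarith
    | succ j ih =>
      obtain ⟨⟨-, h2⟩, -⟩ := hM _ (hlarge j)
      have hs := h.sign_next_eq_neg (hlt j ih)
      have hcast : ((a + 2 ^ k * (i + 1 + 2 * (j + 1)) : ℕ) : ℝ) + (1 - 2 ^ (k + 1))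
          = (a + 2 ^ k * (i + 1 + 2 * j) : ℕ) + 1 := by
        push_cast; ring
      have habs : |greedyError τ (a + 2 ^ k * (i + 1 + 2 * (j + 1)))|
          = |(dyadicDiff (k + 1) 1 ((a + 2 ^ k * (i + 1 + 2 * j) : ℕ) + 1)
            - |greedyError τ (a + 2 ^ k * (i + 1 + 2 * j))|)| := by
        have h5 : dyadicDiff (k + 1) 1 ((a + 2 ^ k * (i + 1 + 2 * j) : ℕ) + 1)
            - |greedyError τ (a + 2 ^ k * (i + 1 + 2 * j))|
            = greedySign τ (a + 2 ^ k * (i + 1 + 2 * j) + 1)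
              * greedyError τ (a + 2 ^ k * (i + 1 + 2 * (j + 1))) := by
          rw [show i + 1 + 2 * (j + 1) = i + 1 + 2 * j + 2 by ring, h.step_two hs, abs_greedyError]
          linear_combination -dyadicDiff (k + 1) 1 ((a + 2 ^ k * (i + 1 + 2 * j) : ℕ) + 1)
            * greedySign_mul_self τ (a + 2 ^ k * (i + 1 + 2 * j) + 1)
        rw [h5, abs_mul, abs_greedySign, one_mul]
      have h0 := abs_nonneg (greedyError τ (a + 2 ^ k * (i + 1 + 2 * j)))
      rw [hcast, habs, abs_le]
      constructor <;> linarith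
  have hflip := fun j => h.sign_next_eq_neg (hlt j (hbound j))
  refine ⟨i + 1, ⟨?_, ?_, ?_, ?_, ?_⟩⟩
  · have := h.le
    rw [pow_succ]
    nlinarith
  · intro j r hr
    rw [hidx]
    rcases lt_or_ge r (2 ^ k) with hrk | hrk
    · exact h.sign _ r hrk
    · obtain ⟨r, rfl⟩ := Nat.exists_eq_add_of_le hrk
      have hrk' : r < 2 ^ k := by rw [pow_succ] at hr; omega
      rw [thueMorseSign_two_pow_add k hrk',
        show a + 2 ^ k * (i + 1 + 2 * j) + (2 ^ k + r) + 1
          = a + 2 ^ k * (i + 1 + 2 * j + 1) + r + 1 by ring, h.sign _ r hrk', hflip]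
      ring
  · intro j
    rw [hidx, hidx]
    exact h.step_two (hflip j)
  · intro j
    rw [hidx]
    exact hbound j
  · obtain ⟨δ, hδ, hoff⟩ := h.off
    refine ⟨min δ (cConst k / 2), lt_min hδ (by linarith), fun n hn => ?_⟩
    have hn1 : (1 : ℝ) ≤ n := by
      have := h.le
      exact_mod_cast (by omega : 1 ≤ n)
    rcases hoff n (by omega) with ⟨q, rfl⟩ | hδn
    · have hq : i + 1 ≤ q := by
        by_contra! hlt
        have := Nat.mul_lt_mul_of_pos_left hlt hpk
        omega
      obtain ⟨j, hj | hj⟩ : ∃ j, q = i + 1 + 2 * j ∨ q = i + 1 + 2 * j + 1 :=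
        ⟨(q - (i + 1)) / 2, by omega⟩
      · left
        exact ⟨j, by rw [hidx, hj]⟩
      · right
        refine (min_le_right _ _).trans ?_
        rw [hj, h.abs_next_of_neg (hflip j)]
        obtain ⟨⟨h1, -⟩, h3⟩ := hM _ (hlarge j)
        refine h1.trans ?_
        have h4 := hlt j (hbound j)
        have h5 := hbound j
        have h6 : (a + 2 ^ k * (i + 1 + 2 * j) : ℕ) ≤ a + 2 ^ k * (i + 1 + 2 * j + 1) :=
          Nat.add_le_add_left (Nat.mul_le_mul_left _ (by omega)) _
        have h7 : ((a + 2 ^ k * (i + 1 + 2 * j) : ℕ) : ℝ)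
            ≤ (a + 2 ^ k * (i + 1 + 2 * j + 1) : ℕ) := by exact_mod_cast h6
        apply mul_le_mul
        · linarith
        · gcongr
        · positivity
        · linarith
    · right
      refine (min_le_left _ _).trans (hδn.trans ?_)
      gcongr
      omega

end GreedyRegular

/-! ### Alternating signs on a regular progression -/

/-- If consecutive sums of a null sequence form a convex sequence, then the null sequence is
antitone: its first differences are antitone along steps of two, and tend to zero. -/
theorem antitone_of_convex_add_succ {y d : ℕ → ℝ} (hy : ∀ i, y i + y (i + 1) = d i)
    (h0 : Tendsto y atTop (𝓝 0)) (hd : ∀ i, 2 * d (i + 1) ≤ d i + d (i + 2)) (i : ℕ) :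
    y (i + 1) ≤ y i := by
  have hz : Antitone fun j : ℕ => y (i + 2 * j) - y (i + 2 * j + 1) := by
    refine antitone_nat_of_succ_le fun j => ?_
    have h1 := hd (i + 2 * j)
    have e1 := hy (i + 2 * j)
    have e2 := hy (i + 2 * j + 1)
    have e3 := hy (i + 2 * j + 2)
    rw [show i + 2 * (j + 1) = i + 2 * j + 2 by ring]
    rw [show i + 2 * j + 1 + 1 = i + 2 * j + 2 by ring] at e2
    linarith
  have ht : Tendsto (fun j : ℕ => i + 2 * j) atTop atTop :=
    tendsto_atTop_mono (fun j => (by omega : j ≤ i + 2 * j)) tendsto_id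
  have hlim := (h0.comp ht).sub (h0.comp ((tendsto_add_atTop_nat 1).comp ht))
  rw [sub_zero] at hlim
  have := hz.le_of_tendsto hlim 0
  simp only [mul_zero, add_zero] at this
  linarith

namespace GreedyRegular

variable {τ : ℝ} {k a : ℕ}

theorem mem_exceptionalSet (h : GreedyRegular τ k a) {i₀ : ℕ} (hs : ∀ i ≥ i₀,
    greedySign τ (a + 2 ^ k * (i + 1) + 1) = -greedySign τ (a + 2 ^ k * i + 1)) :
    τ ∈ exceptionalSet (k + 1) := by
  obtain ⟨i, hi, hone⟩ : ∃ i ≥ i₀, greedySign τ (a + 2 ^ k * i + 1) = 1 := by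
    rcases greedySign_eq τ (a + 2 ^ k * i₀ + 1) with h1 | h1
    · exact ⟨i₀, le_rfl, h1⟩
    · exact ⟨i₀ + 1, by omega, by rw [hs i₀ le_rfl, h1, neg_neg]⟩
  have halt : ∀ q, greedySign τ (a + 2 ^ k * (i + q) + 1) = (-1) ^ q := by
    intro q
    induction q with
    | zero => simpa using hone
    | succ q ih => rw [← add_assoc, hs _ (by omega), ih, pow_succ]; ring
  have hp : 0 < 2 ^ (k + 1) := by positivity
  set t := a + 2 ^ k * i with ht
  -- The shift `m` moves the start `t + 1` of a positive block to a multiple of the period.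
  obtain ⟨m, hm, c, hc⟩ : ∃ m < 2 ^ (k + 1), ∃ c, t + 1 + m = 2 ^ (k + 1) * c := by
    have h1 := Nat.mod_add_div (t + 1) (2 ^ (k + 1))
    have h2 := Nat.mod_lt (t + 1) hp
    rcases Nat.eq_zero_or_pos ((t + 1) % 2 ^ (k + 1)) with h0 | h0
    · exact ⟨0, hp, (t + 1) / 2 ^ (k + 1), by omega⟩
    · refine ⟨2 ^ (k + 1) - (t + 1) % 2 ^ (k + 1), by omega, (t + 1) / 2 ^ (k + 1) + 1, ?_⟩
      rw [mul_add, mul_one]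
      omega
  refine ⟨t + 1, m, hm, fun n _ hn => ?_⟩
  obtain ⟨l, rfl⟩ := Nat.exists_eq_add_of_le hn
  obtain ⟨q, r, hr, rfl⟩ : ∃ q r, r < 2 ^ k ∧ l = 2 ^ k * q + r :=
    ⟨l / 2 ^ k, l % 2 ^ k, Nat.mod_lt _ (by positivity), (Nat.div_add_mod _ _).symm⟩
  have hn' : t + 1 + (2 ^ k * q + r) = a + 2 ^ k * (i + q) + r + 1 := by rw [ht]; ring
  rw [hn', h.sign _ r hr, halt, ← hn', periodicThueMorse]
  obtain ⟨p, rfl | rfl⟩ : ∃ p, q = 2 * p ∨ q = 2 * p + 1 := ⟨q / 2, by omega⟩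
  · have e : t + 1 + (2 ^ k * (2 * p) + r) + m = 2 ^ (k + 1) * (c + p) + r :=
      calc _ = t + 1 + m + 2 ^ (k + 1) * p + r := by ring
        _ = _ := by rw [hc]; ring
    rw [e, Nat.mul_add_mod, Nat.mod_eq_of_lt (by rw [pow_succ]; omega), pow_mul]
    simp
  · have e : t + 1 + (2 ^ k * (2 * p + 1) + r) + m = 2 ^ (k + 1) * (c + p) + (2 ^ k + r) :=
      calc _ = t + 1 + m + 2 ^ (k + 1) * p + (2 ^ k + r) := by ring
        _ = _ := by rw [hc]; ring
    rw [e, Nat.mul_add_mod, Nat.mod_eq_of_lt (by rw [pow_succ]; omega),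
      thueMorseSign_two_pow_add k hr, pow_succ, pow_mul]
    simp

theorem tendsto_index (k a : ℕ) : Tendsto (fun i : ℕ => a + 2 ^ k * i) atTop atTop := by
  refine tendsto_atTop_mono (fun i => ?_) tendsto_id
  have : 1 * i ≤ 2 ^ k * i := Nat.mul_le_mul_right _ Nat.one_le_two_pow
  simp only [id_eq]
  omega

theorem tendsto_error (h : GreedyRegular τ k a) :
    Tendsto (fun i => |greedyError τ (a + 2 ^ k * i)|) atTop (𝓝 0) := by
  have h1 : Tendsto (fun n : ℕ => dyadicDiff k 1 (n + (1 - 2 ^ k))) atTop (𝓝 0) := by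
    have h2 := (tendsto_dyadicDiff k (1 - 2 ^ k)).mul
      ((tendsto_inv_atTop_nhds_zero_nat (𝕜 := ℝ)).pow (k + 1))
    rw [zero_pow (by omega), mul_zero] at h2
    refine h2.congr' ?_
    filter_upwards [eventually_gt_atTop 0] with n hn
    have : (n : ℝ) ≠ 0 := by positivity
    rw [mul_assoc, ← mul_pow, mul_inv_cancel₀ this, one_pow, mul_one]
  exact squeeze_zero (fun _ => abs_nonneg _) h.bound (h1.comp (tendsto_index k a))

/-- With alternating signs, the error is half of the iterated difference, to leading order. -/
theorem eventually_near_half (h : GreedyRegular τ k a) {i₀ : ℕ} (hs : ∀ i ≥ i₀,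
    greedySign τ (a + 2 ^ k * (i + 1) + 1) = -greedySign τ (a + 2 ^ k * i + 1))
    {ε : ℝ} (hε : 0 < ε) : ∀ᶠ n : ℕ in atTop, (∃ i, n = a + 2 ^ k * i) →
      |(|greedyError τ n| * (n : ℝ) ^ (k + 1) - cConst k / 2)| < ε := by
  have hadd : ∀ i, |greedyError τ (a + 2 ^ k * (i₀ + i))|
      + |greedyError τ (a + 2 ^ k * (i₀ + (i + 1)))|
      = dyadicDiff k 1 ((a + 2 ^ k * (i₀ + i) : ℕ) + 1) := by
    intro i
    rw [← add_assoc, h.abs_next_of_neg (hs (i₀ + i) (by omega))]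
    ring
  have hanti := antitone_of_convex_add_succ
    (y := fun i => |greedyError τ (a + 2 ^ k * (i₀ + i))|) hadd
    (h.tendsto_error.comp (tendsto_add_atTop_nat i₀ |>.congr fun i => add_comm i i₀)) (by
      intro i
      have hx : (0 : ℝ) < (a + 2 ^ k * (i₀ + i) : ℕ) + 1 := by positivity
      have h1 := dyadicDiff_antitone (k + 1) 1 hx
        (le_add_of_nonneg_right (by positivity : (0 : ℝ) ≤ 2 ^ k))
      simp only [dyadicDiff] at h1
      have e1 : ((a + 2 ^ k * (i₀ + (i + 1)) : ℕ) : ℝ) + 1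
          = (a + 2 ^ k * (i₀ + i) : ℕ) + 1 + 2 ^ k := by push_cast; ring
      have e2 : ((a + 2 ^ k * (i₀ + (i + 2)) : ℕ) : ℝ) + 1
          = (a + 2 ^ k * (i₀ + i) : ℕ) + 1 + 2 ^ k + 2 ^ k := by push_cast; ring
      rw [e1, e2]
      linarith)
  have hlow := (tendsto_dyadicDiff k 1).div_const 2
  have hupp := (tendsto_dyadicDiff k (1 - 2 ^ k)).div_const 2
  filter_upwards [hlow.eventually (eventually_gt_nhds (sub_lt_self _ hε)),
    hupp.eventually (eventually_lt_nhds (lt_add_of_pos_right _ hε)),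
    eventually_ge_atTop (a + 2 ^ k * (i₀ + 1))] with n h1 h2 hn
  rintro ⟨q, rfl⟩
  have hq : i₀ + 1 ≤ q := by
    by_contra! hlt
    have := Nat.mul_lt_mul_of_pos_left hlt (by positivity : 0 < 2 ^ k)
    omega
  obtain ⟨i, rfl⟩ := Nat.exists_eq_add_of_le hq
  rw [show i₀ + 1 + i = i₀ + (i + 1) by ring] at *
  have l1 := hanti (i + 1)
  have l2 := hanti i
  have e1 := hadd (i + 1)
  have e2 := hadd i
  have e3 : ((a + 2 ^ k * (i₀ + i) : ℕ) : ℝ) + 1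
      = (a + 2 ^ k * (i₀ + (i + 1)) : ℕ) + (1 - 2 ^ k) := by
    push_cast; ring
  rw [e3] at e2
  have hp : (0 : ℝ) ≤ ((a + 2 ^ k * (i₀ + (i + 1)) : ℕ) : ℝ) ^ (k + 1) := by positivity
  have m1 := mul_le_mul_of_nonneg_right (show dyadicDiff k 1 ((a + 2 ^ k * (i₀ + (i + 1)) : ℕ) + 1)
    ≤ 2 * |greedyError τ (a + 2 ^ k * (i₀ + (i + 1)))| by linarith) hp
  have m2 := mul_le_mul_of_nonneg_right (show 2 * |greedyError τ (a + 2 ^ k * (i₀ + (i + 1)))|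
    ≤ dyadicDiff k 1 ((a + 2 ^ k * (i₀ + (i + 1)) : ℕ) + (1 - 2 ^ k)) by linarith) hp
  rw [abs_lt]
  constructor <;> linarith

/-! ### The sizes of the scaled errors -/

theorem eventually_off (h : GreedyRegular τ k a) (M : ℝ) : ∀ᶠ n : ℕ in atTop,
    (∃ i, n = a + 2 ^ k * i) ∨ M ≤ |greedyError τ n| * (n : ℝ) ^ (k + 1) := by
  obtain ⟨δ, hδ, hoff⟩ := h.off
  filter_upwards [eventually_ge_atTop a,
    tendsto_natCast_atTop_atTop.eventually_ge_atTop (M / δ)] with n hn hM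
  refine (hoff n hn).imp_right fun hn' => ?_
  rw [div_le_iff₀ hδ] at hM
  calc M ≤ n * δ := hM
    _ ≤ n * (|greedyError τ n| * (n : ℝ) ^ k) := by gcongr
    _ = _ := by ring

theorem eventually_small (h : GreedyRegular τ (k + 1) a) {ε : ℝ} (hε : 0 < ε) :
    ∀ᶠ n : ℕ in atTop, (∃ i, n = a + 2 ^ (k + 1) * i) →
      |greedyError τ n| * (n : ℝ) ^ (k + 1) < ε := by
  filter_upwards [(tendsto_dyadicDiff_succ_zero k (1 - 2 ^ (k + 1))).eventually
    (eventually_lt_nhds hε)] with n hn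
  rintro ⟨i, rfl⟩
  exact lt_of_le_of_lt (mul_le_mul_of_nonneg_right (h.bound i) (by positivity)) hn

/-- Midway between two terms of a regular progression of the next level, the error is close to a
full iterated difference. -/
theorem eventually_near (h : GreedyRegular τ k a) {i : ℕ}
    (h' : GreedyRegular τ (k + 1) (a + 2 ^ k * i)) {ε : ℝ} (hε : 0 < ε) :
    ∀ᶠ n : ℕ in atTop, (∃ j, n = a + 2 ^ k * i + 2 ^ (k + 1) * j + 2 ^ k) →
      |(|greedyError τ n| * (n : ℝ) ^ (k + 1) - cConst k)| < ε := by
  have t1 := Metric.tendsto_nhds.1 (tendsto_dyadicDiff k (1 - 2 ^ k)) _ (half_pos hε)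
  have t2 := (tendsto_dyadicDiff_succ_zero k (1 - 2 ^ k - 2 ^ (k + 1))).eventually
    (eventually_lt_nhds (half_pos hε))
  filter_upwards [t1, t2] with n h1 h2
  rintro ⟨j, rfl⟩
  set t := a + 2 ^ k * i + 2 ^ (k + 1) * j with ht
  have ht' : t = a + 2 ^ k * (i + 2 * j) := by rw [ht]; ring
  have hs := h.step (i + 2 * j)
  rw [show a + 2 ^ k * (i + 2 * j + 1) = t + 2 ^ k by rw [ht']; ring, ← ht'] at hs
  have hb := h'.bound j
  rw [← ht] at hb
  have e1 : (t : ℝ) + 1 = (t + 2 ^ k : ℕ) + (1 - 2 ^ k) := by push_cast; ring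
  have e2 : (t : ℝ) + (1 - 2 ^ (k + 1)) = (t + 2 ^ k : ℕ) + (1 - 2 ^ k - 2 ^ (k + 1)) := by
    push_cast; ring
  have hpos := dyadicDiff_one_pos k (x := (t : ℝ) + 1) (by positivity)
  have hclose : |(|greedyError τ (t + 2 ^ k)| - dyadicDiff k 1 ((t : ℝ) + 1))|
      ≤ |greedyError τ t| := by
    have e3 : |greedySign τ (t + 1) * dyadicDiff k 1 ((t : ℝ) + 1)|
        = dyadicDiff k 1 ((t : ℝ) + 1) := by
      rw [abs_mul, abs_greedySign, one_mul, abs_of_pos hpos]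
    calc _ = |(|greedyError τ (t + 2 ^ k)|
          - |greedySign τ (t + 1) * dyadicDiff k 1 ((t : ℝ) + 1)|)| := by rw [e3]
      _ ≤ |greedyError τ (t + 2 ^ k)
          - greedySign τ (t + 1) * dyadicDiff k 1 ((t : ℝ) + 1)| := abs_abs_sub_abs_le_abs_sub _ _
      _ = _ := by rw [hs, add_sub_cancel_right]
  rw [Real.dist_eq, abs_lt] at h1
  rw [e1] at hclose
  rw [e2] at hb
  obtain ⟨c1, c2⟩ := abs_le.1 (hclose.trans hb)
  have hp : (0 : ℝ) ≤ ((t + 2 ^ k : ℕ) : ℝ) ^ (k + 1) := by positivity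
  have m1 := mul_le_mul_of_nonneg_right c1 hp
  have m2 := mul_le_mul_of_nonneg_right c2 hp
  obtain ⟨b1, b2⟩ := h1
  rw [abs_lt]
  constructor <;> linarith

theorem mem_succ_or_mid {a i q : ℕ} (hn : a + 2 ^ k * i ≤ a + 2 ^ k * q) :
    (∃ j, a + 2 ^ k * q = a + 2 ^ k * i + 2 ^ (k + 1) * j) ∨
      ∃ j, a + 2 ^ k * q = a + 2 ^ k * i + 2 ^ (k + 1) * j + 2 ^ k := by
  have hq : i ≤ q := by
    by_contra! hlt
    have := Nat.mul_lt_mul_of_pos_left hlt (by positivity : 0 < 2 ^ k)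
    omega
  obtain ⟨j, rfl | rfl⟩ : ∃ j, q = i + 2 * j ∨ q = i + 2 * j + 1 := ⟨(q - i) / 2, by omega⟩
  · exact Or.inl ⟨j, by ring⟩
  · exact Or.inr ⟨j, by ring⟩

/-- A block of level `k + 1` is a block of level `k` followed by its negative, so both signs recur at
every fixed position of the blocks of level `k`. -/
theorem frequently_sign (h : GreedyRegular τ (k + 1) a) {r : ℕ} (hr : r < 2 ^ k) {c : ℝ}
    (hc : c = 1 ∨ c = -1) :
    ∃ᶠ n in atTop, (∃ j, n = a + 2 ^ k * j + r) ∧ greedySign τ (n + 1) = c := by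
  rw [frequently_atTop]
  intro N
  have e1 := h.sign N r (by rw [pow_succ]; omega)
  have e2 := h.sign N (2 ^ k + r) (by rw [pow_succ]; omega)
  rw [thueMorseSign_two_pow_add k hr, mul_neg, ← e1] at e2
  have hN : N ≤ a + 2 ^ (k + 1) * N + r := by
    have : 1 * N ≤ 2 ^ (k + 1) * N := Nat.mul_le_mul_right _ Nat.one_le_two_pow
    omega
  by_cases hcase : greedySign τ (a + 2 ^ (k + 1) * N + r + 1) = c
  · exact ⟨_, hN, ⟨2 * N, by ring⟩, hcase⟩
  · refine ⟨a + 2 ^ (k + 1) * N + (2 ^ k + r), by omega, ⟨2 * N + 1, by ring⟩, ?_⟩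
    rw [e2]
    rcases greedySign_eq τ (a + 2 ^ (k + 1) * N + r + 1) with h1 | h1 <;>
      rcases hc with rfl | rfl <;>
      first | exact absurd h1 hcase | linarith

end GreedyRegular

/-! ### Limit points -/

/-- A finite limit point has absolute value in any closed set to which the absolute values of the
bounded terms of the sequence draw near. -/
theorem mem_limitPoints_cases {k : ℕ} {τ : ℝ} {S : Set ℝ} (hS : IsClosed S)
    (H : ∀ M : ℝ, ∀ ε > 0, ∀ᶠ n : ℕ in atTop, M ≤ |greedyError τ n| * (n : ℝ) ^ k ∨
      ∃ L ∈ S, |(|greedyError τ n| * (n : ℝ) ^ k - L)| < ε)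
    {x : EReal} (hx : x ∈ limitPoints k τ) :
    x = ⊤ ∨ x = ⊥ ∨ ∃ y : ℝ, x = y ∧ |y| ∈ S := by
  induction x with
  | top => exact Or.inl rfl
  | bot => exact Or.inr (Or.inl rfl)
  | coe y =>
    refine Or.inr (Or.inr ⟨y, rfl, ?_⟩)
    rw [← hS.closure_eq, Metric.mem_closure_iff]
    intro ε hε
    have hU : Real.toEReal '' Metric.ball y (min (ε / 2) 1) ∈ 𝓝 (y : EReal) :=
      EReal.isOpenEmbedding_coe.image_mem_nhds.2 (Metric.ball_mem_nhds _ (by positivity))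
    have hf := mapClusterPt_iff_frequently.1 hx _ hU
    obtain ⟨n, ⟨z, hz, hzn⟩, hn⟩ := (hf.and_eventually (H (|y| + 1) (ε / 2) (half_pos hε))).exists
    rw [EReal.coe_eq_coe_iff] at hzn
    rw [Metric.mem_ball, Real.dist_eq, lt_min_iff] at hz
    have habs : |greedyError τ n| * (n : ℝ) ^ k = |z| := by
      rw [hzn, abs_mul, abs_of_nonneg (by positivity : (0 : ℝ) ≤ (n : ℝ) ^ k)]
      rfl
    rw [habs] at hn
    have h1 := abs_abs_sub_abs_le_abs_sub z y
    rcases hn with hn | ⟨L, hL, hn⟩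
    · have := le_abs_self (|z| - |y|)
      linarith [hz.2]
    · refine ⟨L, hL, ?_⟩
      rw [Real.dist_eq]
      calc |(|y| - L)| = |(-(|z| - |y|) + (|z| - L))| := by ring_nf
        _ ≤ |(|z| - |y|)| + |(|z| - L)| := by
          rw [← abs_neg (|z| - |y|)]; exact abs_add_le _ _
        _ < ε := by linarith [hz.1]

theorem greedyError_eq_neg_sign_mul (τ : ℝ) (n : ℕ) :
    greedyError τ n = -greedySign τ (n + 1) * |greedyError τ n| := by
  rw [abs_greedyError]
  linear_combination -greedyError τ n * greedySign_mul_self τ (n + 1)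

/-- The sign of the error is opposite to the next greedy sign, so recurrence of that sign turns
limits of absolute values into limit points. -/
theorem mem_limitPoints_of_frequently {k : ℕ} {τ : ℝ} {P : ℕ → Prop} {c : ℝ} {x : EReal}
    (hP : ∃ᶠ n in atTop, P n ∧ greedySign τ (n + 1) = c)
    (hx : ∀ U ∈ 𝓝 x, ∀ᶠ n : ℕ in atTop, P n →
      ((-c * (|greedyError τ n| * (n : ℝ) ^ k) : ℝ) : EReal) ∈ U) :
    x ∈ limitPoints k τ := by
  refine mapClusterPt_iff_frequently.2 fun U hU => ?_
  refine (hP.and_eventually (hx U hU)).mono ?_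
  rintro n ⟨⟨hn, rfl⟩, hU'⟩
  have h := hU' hn
  rwa [← mul_assoc, ← greedyError_eq_neg_sign_mul] at h

theorem mem_limitPoints_of_near {k : ℕ} {τ : ℝ} {P : ℕ → Prop} {c L : ℝ}
    (hP : ∃ᶠ n in atTop, P n ∧ greedySign τ (n + 1) = c) (hc : c = 1 ∨ c = -1)
    (hL : ∀ ε > 0, ∀ᶠ n : ℕ in atTop, P n → |(|greedyError τ n| * (n : ℝ) ^ k - L)| < ε) :
    ((-c * L : ℝ) : EReal) ∈ limitPoints k τ := by
  refine mem_limitPoints_of_frequently hP fun U hU => ?_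
  obtain ⟨ε, hε, hεU⟩ := Metric.mem_nhds_iff.1 (continuous_coe_real_ereal.continuousAt hU)
  filter_upwards [hL ε hε] with n hn hPn
  apply hεU
  rw [Metric.mem_ball, Real.dist_eq, ← mul_sub, abs_mul]
  have : |(-c)| = 1 := by rcases hc with rfl | rfl <;> simp
  rw [this, one_mul]
  exact hn hPn

theorem top_mem_limitPoints {k : ℕ} {τ : ℝ} {P : ℕ → Prop}
    (hP : ∃ᶠ n in atTop, P n ∧ greedySign τ (n + 1) = -1)
    (hL : ∀ M : ℝ, ∀ᶠ n : ℕ in atTop, P n → M ≤ |greedyError τ n| * (n : ℝ) ^ k) :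
    ⊤ ∈ limitPoints k τ := by
  refine mem_limitPoints_of_frequently hP fun U hU => ?_
  obtain ⟨M, hM⟩ := EReal.mem_nhds_top_iff.1 hU
  filter_upwards [hL (M + 1)] with n hn hPn
  apply hM
  rw [Set.mem_Ioi, EReal.coe_lt_coe_iff]
  linarith [hn hPn]

theorem bot_mem_limitPoints {k : ℕ} {τ : ℝ} {P : ℕ → Prop}
    (hP : ∃ᶠ n in atTop, P n ∧ greedySign τ (n + 1) = 1)
    (hL : ∀ M : ℝ, ∀ᶠ n : ℕ in atTop, P n → M ≤ |greedyError τ n| * (n : ℝ) ^ k) :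
    ⊥ ∈ limitPoints k τ := by
  refine mem_limitPoints_of_frequently hP fun U hU => ?_
  obtain ⟨M, hM⟩ := EReal.mem_nhds_bot_iff.1 hU
  filter_upwards [hL (-M + 1)] with n hn hPn
  apply hM
  rw [Set.mem_Iio, EReal.coe_lt_coe_iff]
  linarith [hn hPn]

/-- If two consecutive levels are regular, the limit points at the lower one avoid `±c_k / 2`. -/
theorem GreedyRegular.limitPoints_subset {τ : ℝ} {k a i : ℕ} (h : GreedyRegular τ k a)
    (h' : GreedyRegular τ (k + 1) (a + 2 ^ k * i)) :
    limitPoints (k + 1) τ ⊆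
      {0, ((cConst k : ℝ) : EReal), ((-cConst k : ℝ) : EReal), ⊤, ⊥} := by
  intro x hx
  have hcases := mem_limitPoints_cases (S := {0, cConst k}) (Set.toFinite _).isClosed (by
    intro M ε hε
    filter_upwards [h.eventually_off M, h'.eventually_small hε, h.eventually_near h' hε,
      eventually_ge_atTop (a + 2 ^ k * i)] with n h1 h2 h3 hn
    rcases h1 with ⟨q, rfl⟩ | h1
    · rcases mem_succ_or_mid hn with hq | hq
      · refine Or.inr ⟨0, by simp, ?_⟩
        rw [sub_zero, abs_of_nonneg (by positivity)]
        exact h2 hq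
      · exact Or.inr ⟨cConst k, by simp, h3 hq⟩
    · exact Or.inl h1) hx
  rcases hcases with rfl | rfl | ⟨y, rfl, hy⟩
  · simp
  · simp
  · rcases hy with hy | hy
    · rw [abs_eq_zero] at hy
      simp [hy]
    · rcases (abs_eq (cConst_pos k).le).1 hy with rfl | rfl <;> simp

/-- Either regularity persists up to level `k`, or the error has settled, at a lower level, to a
size that is not `o(1 / n ^ k)`. -/
theorem greedyRegular_or_eventually_le (τ : ℝ) (k : ℕ) :
    (∃ a, GreedyRegular τ k a) ∨
      ∃ δ > 0, ∀ᶠ n : ℕ in atTop, δ ≤ |greedyError τ n| * (n : ℝ) ^ k := by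
  induction k with
  | zero => exact Or.inl (exists_greedyRegular_zero τ)
  | succ k ih =>
    rcases ih with ⟨a, h⟩ | ⟨δ, hδ, h⟩
    · rcases h.succ_or_alternating with ⟨i, h'⟩ | ⟨i₀, hs⟩
      · exact Or.inl ⟨_, h'⟩
      · right
        have hc := cConst_pos k
        refine ⟨cConst k / 4, by linarith, ?_⟩
        filter_upwards [h.eventually_off (cConst k / 4),
          h.eventually_near_half hs (ε := cConst k / 4) (by linarith)] with n h1 h2
        rcases h1 with h1 | h1
        · have := (abs_lt.1 (h2 h1)).1
          linarith
        · exact h1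
    · refine Or.inr ⟨δ, hδ, ?_⟩
      filter_upwards [h, eventually_ge_atTop 1] with n hn hn1
      refine hn.trans ?_
      have : (1 : ℝ) ≤ n := by exact_mod_cast hn1
      gcongr
      omega

theorem limitPoints_subset (k : ℕ) (τ : ℝ) :
    limitPoints (k + 1) τ ⊆
      {0, ((cConst k : ℝ) : EReal), ((-cConst k : ℝ) : EReal),
        ((cConst k / 2 : ℝ) : EReal), ((-(cConst k / 2) : ℝ) : EReal), ⊤, ⊥} := by
  intro x hx
  rcases greedyRegular_or_eventually_le τ k with ⟨a, h⟩ | ⟨δ, hδ, h⟩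
  · rcases h.succ_or_alternating with ⟨i, h'⟩ | ⟨i₀, hs⟩
    · have := h.limitPoints_subset h' hx
      simp only [Set.mem_insert_iff, Set.mem_singleton_iff] at this ⊢
      tauto
    · have hcases := mem_limitPoints_cases (S := {cConst k / 2}) isClosed_singleton (by
        intro M ε hε
        filter_upwards [h.eventually_off M, h.eventually_near_half hs hε] with n h1 h2
        rcases h1 with h1 | h1
        · exact Or.inr ⟨_, rfl, h2 h1⟩
        · exact Or.inl h1) hx
      rcases hcases with rfl | rfl | ⟨y, rfl, hy⟩
      · simp
      · simp
      · rcases (abs_eq (half_pos (cConst_pos k)).le).1 hy with rfl | rfl <;> simp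
  · have hcases := mem_limitPoints_cases (S := ∅) isClosed_empty (by
      intro M ε _
      filter_upwards [h, tendsto_natCast_atTop_atTop.eventually_ge_atTop (M / δ)] with n hn hM
      left
      rw [div_le_iff₀ hδ] at hM
      calc M ≤ n * δ := hM
        _ ≤ n * (|greedyError τ n| * (n : ℝ) ^ k) := by gcongr
        _ = _ := by ring) hx
    rcases hcases with rfl | rfl | ⟨y, -, hy⟩
    · simp
    · simp
    · exact hy.elim

theorem GreedyRegular.exists_succ {τ : ℝ} {k a : ℕ} (h : GreedyRegular τ k a)
    (hτ : τ ∉ exceptionalUnion) : ∃ i, GreedyRegular τ (k + 1) (a + 2 ^ k * i) := by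
  rcases h.succ_or_alternating with h' | ⟨i₀, hs⟩
  · exact h'
  · exact (hτ ⟨k + 1, by omega, h.mem_exceptionalSet hs⟩).elim

theorem exists_greedyRegular {τ : ℝ} (hτ : τ ∉ exceptionalUnion) (k : ℕ) :
    ∃ a, GreedyRegular τ k a := by
  induction k with
  | zero => exact exists_greedyRegular_zero τ
  | succ k ih =>
    obtain ⟨a, h⟩ := ih
    obtain ⟨i, h'⟩ := h.exists_succ hτ
    exact ⟨_, h'⟩

theorem limitPoints_eq {τ : ℝ} (hτ : τ ∉ exceptionalUnion) {k : ℕ} (hk : 1 ≤ k) :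
    limitPoints (k + 1) τ =
      {0, ((cConst k : ℝ) : EReal), ((-cConst k : ℝ) : EReal), ⊤, ⊥} := by
  obtain ⟨a, h⟩ := exists_greedyRegular hτ k
  obtain ⟨i, h'⟩ := h.exists_succ hτ
  obtain ⟨j, h''⟩ := h'.exists_succ hτ
  refine Set.Subset.antisymm (h.limitPoints_subset h') ?_
  have hk2 : 2 ≤ 2 ^ k := le_self_pow₀ (by norm_num) (by omega)
  have hkk : 2 ^ (k + 1) = 2 ^ k * 2 := pow_succ 2 k
  have hsign : ∀ r < 2 ^ (k + 1), ∀ c : ℝ, c = 1 ∨ c = -1 → ∃ᶠ n in atTop,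
      (∃ q, n = a + 2 ^ k * i + 2 ^ (k + 1) * q + r) ∧ greedySign τ (n + 1) = c := by
    intro r hr c hc
    refine (h''.frequently_sign hr hc).mono ?_
    rintro n ⟨⟨q, rfl⟩, hn⟩
    exact ⟨⟨j + q, by ring⟩, hn⟩
  -- As `k ≥ 1`, the position right after a term lies off the progression of level `k`.
  have hinf : ∀ M : ℝ, ∀ᶠ n : ℕ in atTop,
      (∃ q, n = a + 2 ^ k * i + 2 ^ (k + 1) * q + 1) →
        M ≤ |greedyError τ n| * (n : ℝ) ^ (k + 1) := by
    intro M
    filter_upwards [h.eventually_off M] with n hn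
    rintro ⟨q, rfl⟩
    rcases hn with ⟨p, hp⟩ | hn
    · exfalso
      have h1 : 2 ^ k * (i + 2 * q) + 1 = 2 ^ k * p := by rw [hkk] at hp; linarith
      have h2 := congrArg (· % 2 ^ k) h1
      simp only [Nat.mul_add_mod, Nat.mul_mod_right] at h2
      rw [Nat.mod_eq_of_lt (by omega)] at h2
      omega
    · exact hn
  rintro x (rfl | rfl | rfl | rfl | rfl)
  · have hz := mem_limitPoints_of_near (k := k + 1) (L := 0)
      (hsign 0 (by positivity) 1 (Or.inl rfl)) (Or.inl rfl) (by
        intro ε hε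
        filter_upwards [h'.eventually_small hε] with n hn hq
        rw [sub_zero, abs_of_nonneg (by positivity)]
        exact hn hq)
    simpa using hz
  · have hz := mem_limitPoints_of_near (hsign (2 ^ k) (by omega) (-1) (Or.inr rfl)) (Or.inr rfl)
      (fun ε hε => h.eventually_near h' hε)
    rwa [neg_neg, one_mul] at hz
  · have hz := mem_limitPoints_of_near (hsign (2 ^ k) (by omega) 1 (Or.inl rfl)) (Or.inl rfl)
      (fun ε hε => h.eventually_near h' hε)
    rwa [neg_one_mul] at hz
  · exact top_mem_limitPoints (hsign 1 (by omega) (-1) (Or.inr rfl)) hinf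
  · exact bot_mem_limitPoints (hsign 1 (by omega) 1 (Or.inl rfl)) hinf

theorem mainTheorem7 :
    (∀ (k : ℕ) (τ : ℝ),
      limitPoints (k + 1) τ ⊆
        {0, ((cConst k : ℝ) : EReal), ((-cConst k : ℝ) : EReal),
          ((cConst k / 2 : ℝ) : EReal), ((-(cConst k / 2) : ℝ) : EReal), ⊤, ⊥}) ∧
    (∀ τ : ℝ, τ ∉ exceptionalUnion → ∀ k : ℕ, 1 ≤ k →
      limitPoints (k + 1) τ =
        {0, ((cConst k : ℝ) : EReal), ((-cConst k : ℝ) : EReal), ⊤, ⊥}) := by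
  exact ⟨limitPoints_subset, fun _ hτ _ hk => limitPoints_eq hτ hk⟩
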